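/- **Setting.** There are $N\ge 1$ servers, each storing the same $K$ messages $W_1,\dots,W_K$, which consist of $L$ independent uniform bits each. The requests $(S,X)$ are random in $[K]\times[K]$ with joint distribution $p_{S,X}$ and are independent of the messages; $S$ is private, $X$ is not. In a *scheme* the user draws a random key $\mathsf F$ from a finite set, with a distribution that may depend on $(S,X)$, and sends to server $i$ two queries $(Q_i^{(S)},Q_i^{(X)})=\Phi_i(S,X,\mathsf F)$. Server $i$ answers each query by a bit string $A_i^{(S)}$, resp. $A_i^{(X)}$, that is a function of the messages and of that query, and whose length $\ell(\cdot)$ is a function of the query alone (the same function for all servers and both requests). The scheme is *correct* if $H(W_S\mid S,\mathsf F,Q^{(S)}_{1:N},A^{(S)}_{1:N})=0$ and $H(W_X\mid X,\mathsf F,Q^{(X)}_{1:N},A^{(X)}_{1:N})=0$, and *private* if $I(S;Q_i^{(S)},Q_i^{(X)})=0$ for every server $i\in[N]$. Its download costs are $\alpha^{(S)}=\sum_{i=1}^N \mathbb E[\ell(Q_i^{(S)})]/L$ and $\alpha^{(X)}=\sum_{i=1}^N \mathbb E[\ell(Q_i^{(X)})]/L$. Let $$C(N,k)=1+N^{-1}+\dots+N^{-(k-1)}\qquad\Bigl(=\bigl(1-\tfrac1N\bigr)^{-1}\bigl(1-\tfrac1{N^{k}}\bigr)\text{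 if }N\ge2\Bigr)$$ be the inverse of the capacity of private information retrieval (PIR) with $N$ servers and $k$ messages. Let $P(X=x\mid S=s)$ be the conditional probabilities (for values $s$ of probability zero, any fixed probability distributions on $[K]$). For $1\le j\le K$ let $\lambda_j=\sum_{x\in[K]}m_j(x)$, where $m_j(x)$ is the $j$-th smallest of the $K$ numbers $P(X=x\mid S=s)$, $s\in[K]$ (counted with multiplicity). Put $\lambda_0=0$ and $\theta_j=\min\{1,\lambda_j\}-\min\{1,\lambda_{j-1}\}$. **Theorem.** For all $K$ and all $N\ge 1$ there is a message length $L\ge1$ such that for every joint distribution $p_{S,X}$ on $[K]\times[K]$ there are a correct and private scheme, with $\alpha^{(S)}=C(N,K)$, and a random set $U\subseteq[K]$, a function of $(S,X,\mathsf F)$, with the following properties. 1. (Obfuscation) $X\in U$ almost surely, and $I(S;U)=0$. 2. (Capacity-achieving PIR over the messages indexed by $U$) The answers $A_i^{(X)}$ depend on the messages only through $(W_k)_{k\in U}$; $I(Q_i^{(X)};X\mid U)=0$ and $I(Q_i^{(X)};S\mid X,U)=0$ for every $i\in[N]$; and given $U=u$ (for every $u$ with $P(U=u)>0$) the expected normalized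 download $\sum_i\mathbb E[\ell(Q_i^{(X)})\mid U=u]/L$ for the non-private request equals $C(N,|u|)$. 3. (Download cost) $\alpha^{(X)}=\mathbb E\bigl[C(N,|U|)\bigr]$, that is, for $N\ge2$, $\alpha^{(X)}=\mathbb E\bigl[(1-\tfrac1N)^{-1}(1-\tfrac1{N^{|U|}})\bigr]$. 4. (Size of $U$) $P(|U|\le i)\ge\sum_{j=1}^i\theta_j$ for every $i=1,\dots,K$. -/

import Mathlib

noncomputable section

namespace IntermittentPIR

/-! Probability and information on a finite sample space `Ω` with probability weights `μ`. -/

/-- The probability of an event. -/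
def prob {Ω : Type*} [Fintype Ω] (μ : Ω → ℝ) (E : Set Ω) : ℝ :=
  ∑ ω, E.indicator μ ω

/-- The expectation of a real random variable. -/
def expect {Ω : Type*} [Fintype Ω] (μ : Ω → ℝ) (f : Ω → ℝ) : ℝ :=
  ∑ ω, μ ω * f ω

/-- The probability mass function of a random variable: `massFn μ Y y = P(Y = y)`. -/
def massFn {Ω α : Type*} [Fintype Ω] (μ : Ω → ℝ) (Y : Ω → α) (y : α) : ℝ :=
  prob μ {ω | Y ω = y}

/-- The conditional entropy in bits, `H(Y | Z) = E[-log₂ (P(Y, Z) / P(Z))]`. -/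
def condEntropy {Ω α β : Type*} [Fintype Ω] (μ : Ω → ℝ) (Y : Ω → α) (Z : Ω → β) : ℝ :=
  expect μ fun ω =>
    -Real.logb 2 (massFn μ (fun ω => (Y ω, Z ω)) (Y ω, Z ω) / massFn μ Z (Z ω))

/-- The mutual information in bits, `I(Y; Z) = E[log₂ (P(Y, Z) / (P(Y) P(Z)))]`. -/
def mutualInfo {Ω α β : Type*} [Fintype Ω] (μ : Ω → ℝ) (Y : Ω → α) (Z : Ω → β) : ℝ :=
  expect μ fun ω =>
    Real.logb 2 (massFn μ (fun ω => (Y ω, Z ω)) (Y ω, Z ω) /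
      (massFn μ Y (Y ω) * massFn μ Z (Z ω)))

/-- The conditional mutual information in bits,
`I(Y; Z | V) = E[log₂ (P(Y, Z, V) P(V) / (P(Y, V) P(Z, V)))]`. -/
def condMutualInfo {Ω α β γ : Type*} [Fintype Ω] (μ : Ω → ℝ)
    (Y : Ω → α) (Z : Ω → β) (V : Ω → γ) : ℝ :=
  expect μ fun ω =>
    Real.logb 2
      (massFn μ (fun ω => (Y ω, Z ω, V ω)) (Y ω, Z ω, V ω) * massFn μ V (V ω) /
        (massFn μ (fun ω => (Y ω, V ω)) (Y ω, V ω) *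
          massFn μ (fun ω => (Z ω, V ω)) (Z ω, V ω)))

/-! Retrieval schemes. -/

/-- The contents of `K` messages of `L` bits each. -/
abbrev Messages (K L : ℕ) : Type := Fin K → Fin L → Bool

/-- A two-request retrieval scheme with `K` messages of `L` bits replicated on `N` servers. -/
structure Scheme (K N L : ℕ) where
  /-- The alphabet of the user's random key. -/
  Key : Type
  /-- The key alphabet is finite. -/
  [fintypeKey : Fintype Key]
  /-- The common alphabet of queries. -/
  Query : Type
  /-- The distribution of the key; it may depend on the pair `(s, x)` of requests. -/
  keyDist : Fin K × Fin K → Key → ℝ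
  /-- The key distributions are probability distributions. -/
  keyDist_mem : ∀ r, keyDist r ∈ stdSimplex ℝ Key
  /-- The query functions: server `i` gets the pair of queries for the private and for the
  non-private request. -/
  query : Fin N → Fin K → Fin K → Key → Query × Query
  /-- The length of an answer is a function of the query, the same for all servers and for both
  requests. -/
  len : Query → ℕ
  /-- The answer of server `i`, a bit string determined by the stored messages and the query. -/
  answer : Fin N → Messages K L → Query → List Bool
  /-- The answer to `q` has length `len q`. -/
  answer_length : ∀ i W q, (answer i W q).length = len q

attribute [instance] Scheme.fintypeKey

namespace Scheme

variable {K N L : ℕ} (c : Scheme K N L)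

/-- The sample space: message contents, requests `(S, X)`, key. -/
abbrev Sample : Type := Messages K L × (Fin K × Fin K) × c.Key

/-- The joint law: the messages consist of independent uniform bits and are independent of the
requests and the key; the requests have distribution `p`; given the requests the key has
distribution `keyDist`. -/
def law (p : Fin K × Fin K → ℝ) (ω : c.Sample) : ℝ :=
  (Fintype.card (Messages K L) : ℝ)⁻¹ * p ω.2.1 * c.keyDist ω.2.1 ω.2.2

/-- The private request `S`. -/
def reqS (ω : c.Sample) : Fin K := ω.2.1.1

/-- The non-private request `X`. -/
def reqX (ω : c.Sample) : Fin K := ω.2.1.2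

/-- The random key. -/
def key (ω : c.Sample) : c.Key := ω.2.2

/-- The query to server `i` for the private request. -/
def queryS (i : Fin N) (ω : c.Sample) : c.Query := (c.query i ω.2.1.1 ω.2.1.2 ω.2.2).1

/-- The query to server `i` for the non-private request. -/
def queryX (i : Fin N) (ω : c.Sample) : c.Query := (c.query i ω.2.1.1 ω.2.1.2 ω.2.2).2

/-- The answer of server `i` for the private request. -/
def answerS (i : Fin N) (ω : c.Sample) : List Bool := c.answer i ω.1 (c.queryS i ω)

/-- The answer of server `i` for the non-private request. -/
def answerX (i : Fin N) (ω : c.Sample) : List Bool := c.answer i ω.1 (c.queryX i ω)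

/-- Correctness: each desired message is determined by the corresponding request, the key, and
the corresponding queries and answers, that is
`H(W_S | S, F, Q^S, A^S) = 0` and `H(W_X | X, F, Q^X, A^X) = 0`. -/
def Correct (p : Fin K × Fin K → ℝ) : Prop :=
  condEntropy (c.law p) (fun ω => ω.1 (c.reqS ω))
    (fun ω => (c.reqS ω, c.key ω, (fun i => c.queryS i ω), fun i => c.answerS i ω)) = 0 ∧
  condEntropy (c.law p) (fun ω => ω.1 (c.reqX ω))
    (fun ω => (c.reqX ω, c.key ω, (fun i => c.queryX i ω), fun i => c.answerX i ω)) = 0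

/-- Privacy: no single server learns anything about `S` from its two queries. -/
def Private (p : Fin K × Fin K → ℝ) : Prop :=
  ∀ i : Fin N, mutualInfo (c.law p) c.reqS (fun ω => (c.queryS i ω, c.queryX i ω)) = 0

/-- The normalized download cost for the private request. -/
def costS (p : Fin K × Fin K → ℝ) : ℝ :=
  ∑ i : Fin N, expect (c.law p) (fun ω => (c.len (c.queryS i ω) : ℝ)) / L

/-- The normalized download cost for the non-private request. -/
def costX (p : Fin K × Fin K → ℝ) : ℝ :=
  ∑ i : Fin N, expect (c.law p) (fun ω => (c.len (c.queryX i ω) : ℝ)) / L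

end Scheme

/-- The inverse capacity `C(N, k) = 1 + N⁻¹ + ⋯ + N^{-(k-1)}` of private information retrieval
with `N` servers and `k` messages. -/
def pirCost (N k : ℕ) : ℝ := ∑ j ∈ Finset.range k, ((N : ℝ) ^ j)⁻¹

namespace Scheme

variable {K N L : ℕ} (c : Scheme K N L)

/-- A random set of messages chosen by the user from the requests and the key. -/
def obfSet (u : Fin K → Fin K → c.Key → Finset (Fin K)) (ω : c.Sample) : Finset (Fin K) :=
  u ω.2.1.1 ω.2.1.2 ω.2.2

/-- `U` obfuscates `X`: it contains `X` almost surely and is independent of `S`. -/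
def IsObfuscation (p : Fin K × Fin K → ℝ) (u : Fin K → Fin K → c.Key → Finset (Fin K)) : Prop :=
  prob (c.law p) {ω | c.reqX ω ∈ c.obfSet u ω} = 1 ∧
  mutualInfo (c.law p) c.reqS (c.obfSet u) = 0

/-- The non-private request is retrieved by a capacity-achieving PIR scheme over the messages
indexed by `U`: the answers involve only these messages; given `U`, the query to each server is
independent of `X`; given `X` and `U`, it is independent of `S`; and given `U = v`, the
normalized expected download is `C(N, |v|)`. -/
def RetrievesOver (p : Fin K × Fin K → ℝ)
    (u : Fin K → Fin K → c.Key → Finset (Fin K)) : Prop :=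
  (∀ (i : Fin N) (s x : Fin K) (f : c.Key) (W W' : Messages K L),
    (∀ k ∈ u s x f, W k = W' k) →
      c.answer i W (c.query i s x f).2 = c.answer i W' (c.query i s x f).2) ∧
  (∀ i : Fin N, condMutualInfo (c.law p) (c.queryX i) c.reqX (c.obfSet u) = 0) ∧
  (∀ i : Fin N, condMutualInfo (c.law p) (c.queryX i) c.reqS
    (fun ω => (c.reqX ω, c.obfSet u ω)) = 0) ∧
  ∀ v : Finset (Fin K), 0 < prob (c.law p) {ω | c.obfSet u ω = v} →
    (∑ i : Fin N, expect (c.law p)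
      ({ω | c.obfSet u ω = v}.indicator fun ω => (c.len (c.queryX i ω) : ℝ)) / L) /
        prob (c.law p) {ω | c.obfSet u ω = v} = pirCost N v.card

end Scheme

/-! The bound on the size of the obfuscation set. -/

/-- `w s x` is a version of `P(X = x | S = s)` for the joint distribution `p` of `(S, X)`; the
rows of probability zero may be arbitrary probability distributions. -/
def IsConditional {K : ℕ} (p : Fin K × Fin K → ℝ) (w : Fin K → Fin K → ℝ) : Prop :=
  (∀ s, w s ∈ stdSimplex ℝ (Fin K)) ∧ ∀ s x, p (s, x) = (∑ x', p (s, x')) * w s x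

/-- `lam w j` is the sum over `x` of the `j`-th smallest of the numbers `w s x`, `s ∈ [K]`, for
`j = 1, …, K`, with `lam w 0 = 0`. Here `Tuple.sort` orders the column of `x` increasingly. -/
def lam {K : ℕ} (w : Fin K → Fin K → ℝ) : ℕ → ℝ
  | 0 => 0
  | j + 1 => if h : j < K then ∑ x, w (Tuple.sort (fun s => w s x) ⟨j, h⟩) x else 0

/-- `θ_j = min {1, λ_j} - min {1, λ_{j-1}}`, for `j = 1, …, K`. -/
def theta {K : ℕ} (w : Fin K → Fin K → ℝ) (j : ℕ) : ℝ :=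
  min 1 (lam w j) - min 1 (lam w (j - 1))

end IntermittentPIR

end

/-!
A symmetric retrieval scheme turns into the required two-request scheme once a suitable random set
`U` is available, so there are two constructions.

*Retrieval.* With `N = L + 1 ≥ 2` servers and messages of `L` bits, add a dummy bit `0` to every
message, which gives positions in `ℤ / N`. To retrieve message `x` over `U`, draw a uniform vector
`r` of positions and ask server `i` for the exclusive or over `k ∈ U` of the bits at the positions
`r k`, with `r x` replaced by `r x + i`. The servers use each position of message `x` once; the one
that uses the dummy reveals the interference of the other messages, hence all bits of message `x`
are found (`eq_of_xorAnswer_eq`). Each query is a translate of a uniform vector, so its law does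
not depend on `x`. A server that is asked for dummies only, with probability `N^{-|U|}`, sends
nothing; the expected download is `N (1 - N^{-|U|}) = L * pirCost N |U|`. A single server sends all
messages of `U`. Both cases have the form `SymmetricPIR`, in which privacy is evident.

*Obfuscation.* Cut the column of `x` in the matrix `w s x = P(X = x | S = s)` at its entries in
increasing order. The `j`-th piece (counted from `0`) lies below all entries but `j` of them, so it
is covered by the laws of all but `j` values of `s`. The pieces number `j` have total mass
`λ_{j+1} - λ_j`. Scaling them down to the mass `θ_{j+1}` leaves pieces of total mass `1`, from which
one cell `(y, j)` is drawn. Each `s` whose law does not cover the cell gets a substitute for `y`,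
drawn from the part of its law outside the cells it covers; what an `s` lacks in the cells equals
what it has left outside, so that `y`, or its substitute, has the law `w s` (`sum_couplingReq`). The
set `U` consists of `y` and of all substitutes. It contains the request for every `s`, is drawn
without reference to `s`, and has at most `j + 1` elements, and `|U| ≤ i` has probability at least
`θ_1 + ⋯ + θ_i` (`sum_theta_le`).

The user draws `U` from its conditional law given `(S, X)` in this coupling, retrieves `S` over all
messages and `X` over `U` with independent randomness. All information quantities vanish because
the joint mass functions factor (`SymmetricPIR.expect_scheme`).
-/

noncomputable section

namespace IntermittentPIR

/-! ### Probability on finite sample spaces -/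

section Probability

variable {Ω α β γ : Type*} [Fintype Ω] {μ : Ω → ℝ}

lemma prob_eq_expect (E : Ω → Prop) [DecidablePred E] :
    prob μ {ω | E ω} = expect μ fun ω => if E ω then 1 else 0 := by
  simp [prob, expect, Set.indicator_apply]

lemma massFn_eq_expect [DecidableEq α] (Y : Ω → α) (y : α) :
    massFn μ Y y = expect μ fun ω => if Y ω = y then 1 else 0 :=
  prob_eq_expect _

lemma massFn_eq_sum_fst [Fintype α] (Y : Ω → α) (Z : Ω → β) (z : β) :
    massFn μ Z z = ∑ y, massFn μ (fun ω => (Y ω, Z ω)) (y, z) := by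
  classical
  simp only [massFn_eq_expect, expect, Prod.mk.injEq, ite_and]
  rw [Finset.sum_comm]
  refine Finset.sum_congr rfl fun ω _ => ?_
  rw [← Finset.mul_sum]
  simp

lemma massFn_eq_sum_snd [Fintype β] (Y : Ω → α) (Z : Ω → β) (y : α) :
    massFn μ Y y = ∑ z, massFn μ (fun ω => (Y ω, Z ω)) (y, z) := by
  rw [massFn_eq_sum_fst Z Y]
  refine Finset.sum_congr rfl fun z _ => ?_
  simp only [massFn, Prod.mk.injEq, and_comm]

lemma sum_massFn [Fintype α] (Y : Ω → α) : ∑ y, massFn μ Y y = ∑ ω, μ ω := by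
  classical
  simp only [massFn_eq_expect, expect]
  rw [Finset.sum_comm]
  simp

/-- The logarithm of a ratio with equal numerator and denominator vanishes, also when both are
zero, because then the ratio is the junk value `0`. -/
lemma logb_div_eq_zero {a b : ℝ} (h : a = b) : Real.logb 2 (a / b) = 0 := by
  subst h
  by_cases ha : a = 0 <;> simp [ha]

/-- A product form of the joint mass function makes the mutual information vanish; the factors
need not be normalized. -/
lemma mutualInfo_eq_zero_of_factor [Fintype α] [Fintype β] (hμ : ∑ ω, μ ω = 1)
    (Y : Ω → α) (Z : Ω → β) (a : α → ℝ) (b : β → ℝ)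
    (h : ∀ y z, massFn μ (fun ω => (Y ω, Z ω)) (y, z) = a y * b z) :
    mutualInfo μ Y Z = 0 := by
  have hY : ∀ y, massFn μ Y y = a y * ∑ z, b z := fun y => by
    simp only [massFn_eq_sum_snd Y Z, h, Finset.mul_sum]
  have hZ : ∀ z, massFn μ Z z = (∑ y, a y) * b z := fun z => by
    simp only [massFn_eq_sum_fst Y Z, h, Finset.sum_mul]
  have h1 : (∑ y, a y) * ∑ z, b z = 1 := by
    rw [← hμ, ← sum_massFn Y, Finset.sum_mul]
    simp only [hY]
  refine Finset.sum_eq_zero fun ω _ => mul_eq_zero_of_right _ (logb_div_eq_zero ?_)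
  rw [h, hY, hZ]
  linear_combination (-(a (Y ω) * b (Z ω))) * h1

lemma condMutualInfo_eq_zero_of_factor [Fintype α] [Fintype β]
    (Y : Ω → α) (Z : Ω → β) (V : Ω → γ) (a : α → γ → ℝ) (b : β → γ → ℝ)
    (h : ∀ y z v, massFn μ (fun ω => (Y ω, Z ω, V ω)) (y, z, v) = a y v * b z v) :
    condMutualInfo μ Y Z V = 0 := by
  have hZV : ∀ z v, massFn μ (fun ω => (Z ω, V ω)) (z, v) = (∑ y, a y v) * b z v := fun z v => by
    simp only [massFn_eq_sum_fst Y (fun ω => (Z ω, V ω)), h, Finset.sum_mul]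
  have hYV : ∀ y v, massFn μ (fun ω => (Y ω, V ω)) (y, v) = a y v * ∑ z, b z v := fun y v => by
    rw [massFn_eq_sum_fst Z (fun ω => (Y ω, V ω)), Finset.mul_sum]
    refine Finset.sum_congr rfl fun z _ => ?_
    rw [← h]
    simp only [massFn, Prod.mk.injEq, and_left_comm]
  have hV : ∀ v, massFn μ V v = (∑ y, a y v) * ∑ z, b z v := fun v => by
    simp only [massFn_eq_sum_fst Z V, hZV, Finset.mul_sum]
  refine Finset.sum_eq_zero fun ω _ => mul_eq_zero_of_right _ (logb_div_eq_zero ?_)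
  rw [h, hYV, hZV, hV]
  ring

/-- The conditional entropy of `Y` given `Z` vanishes when `Z` determines `Y` on the support. -/
lemma condEntropy_eq_zero_of_determined (Y : Ω → α) (Z : Ω → β)
    (h : ∀ ω ω', μ ω ≠ 0 → μ ω' ≠ 0 → Z ω = Z ω' → Y ω = Y ω') :
    condEntropy μ Y Z = 0 := by
  classical
  refine Finset.sum_eq_zero fun ω _ => ?_
  by_cases hω : μ ω = 0
  · simp [hω]
  refine mul_eq_zero_of_right _ (neg_eq_zero.mpr (logb_div_eq_zero ?_))
  simp only [massFn_eq_expect, expect]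
  refine Finset.sum_congr rfl fun ω' _ => ?_
  by_cases hω' : μ ω' = 0
  · simp [hω']
  by_cases hZ : Z ω' = Z ω
  · simp [hZ, h ω' ω hω' hω hZ]
  · simp [hZ]

end Probability

/-! ### Symmetric private information retrieval -/

/-- A private information retrieval scheme that works over every set `U` of messages and whose
privacy is visible from its form: for uniform randomness `r`, the query for message `x` over `U`
to server `i` is `base U (shift i x r)` with a bijection `shift i x`, so its law depends on `U`
only. The field `cost` says that the expected download over `U` is `L * pirCost N U.card`. -/
structure SymmetricPIR (K N L : ℕ) where
  Rand : Type
  [fintypeRand : Fintype Rand]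
  [nonemptyRand : Nonempty Rand]
  Query : Type
  [fintypeQuery : Fintype Query]
  base : Finset (Fin K) → Rand → Query
  shift : Fin N → Fin K → Rand ≃ Rand
  len : Query → ℕ
  answer : Messages K L → Query → List Bool
  answer_length : ∀ W q, (answer W q).length = len q
  answer_congr : ∀ U r W W', (∀ k ∈ U, W k = W' k) → answer W (base U r) = answer W' (base U r)
  decode : ∀ U x r W W', x ∈ U →
    (∀ i, answer W (base U (shift i x r)) = answer W' (base U (shift i x r))) → W x = W' x
  cost : ∀ U, (N : ℝ) * ∑ r, (len (base U r) : ℝ) = Fintype.card Rand * (L * pirCost N U.card)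

attribute [instance] SymmetricPIR.fintypeRand SymmetricPIR.nonemptyRand SymmetricPIR.fintypeQuery

/-- With a single server all messages of `U` are downloaded. -/
def singleServerPIR (K : ℕ) : SymmetricPIR K 1 1 where
  Rand := Unit
  Query := Finset (Fin K)
  base U _ := U
  shift _ _ := Equiv.refl _
  len U := U.card
  answer W U := (U.sort (· ≤ ·)).map fun k => W k 0
  answer_length W U := by simp
  answer_congr U _ W W' h := by
    refine List.map_congr_left fun k hk => ?_
    rw [h k ((Finset.mem_sort _).mp hk)]
  decode U x _ W W' hx h := by
    have h0 := List.map_inj_left.mp (h 0) x ((Finset.mem_sort _).mpr hx)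
    funext j
    rwa [Subsingleton.elim j 0]
  cost U := by simp [pirCost]

section ManyServers

variable {K L : ℕ}

/-- The bit of a message at position `q`, where position `0` is a dummy that holds the bit
`false` and position `j + 1` holds the bit `j`. -/
def paddedBit (m : Fin L → Bool) (q : Fin (L + 1)) : Bool :=
  (Fin.cons false m : Fin (L + 1) → Bool) q

@[simp] lemma paddedBit_zero (m : Fin L → Bool) : paddedBit m 0 = 0 := rfl

@[simp] lemma paddedBit_succ (m : Fin L → Bool) (j : Fin L) : paddedBit m j.succ = m j := rfl

/-- The exclusive or (the sum in the Boolean ring `Bool`) of the bits at the positions `q k` of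
the messages `k`. -/
def xorBits (W : Messages K L) (q : Fin K → Fin (L + 1)) : Bool :=
  ∑ k, paddedBit (W k) (q k)

/-- The query vector that agrees with `r` on `U` and asks for the dummy bit elsewhere. -/
def mask (U : Finset (Fin K)) (r : Fin K → Fin (L + 1)) (k : Fin K) : Fin (L + 1) :=
  if k ∈ U then r k else 0

/-- The exclusive or of the requested bits, not sent when only dummy bits are requested. -/
def xorAnswer (W : Messages K L) (q : Fin K → Fin (L + 1)) : List Bool :=
  if q = 0 then [] else [xorBits W q]

lemma xorBits_eq_of_xorAnswer_eq {W W' : Messages K L} {q : Fin K → Fin (L + 1)}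
    (h : xorAnswer W q = xorAnswer W' q) : xorBits W q = xorBits W' q := by
  by_cases hq : q = 0
  · simp [hq, xorBits]
  · simpa [xorAnswer, hq] using h

lemma xorBits_mask_congr (U : Finset (Fin K)) (r : Fin K → Fin (L + 1)) (W W' : Messages K L)
    (h : ∀ k ∈ U, W k = W' k) : xorBits W (mask U r) = xorBits W' (mask U r) := by
  refine Finset.sum_congr rfl fun k _ => ?_
  by_cases hk : k ∈ U
  · rw [h k hk]
  · simp [mask, hk]

/-- The bit of message `x` and the interference, which does not depend on the server `i`. -/
lemma xorBits_mask_add_single {U : Finset (Fin K)} {x : Fin K} (hx : x ∈ U)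
    (r : Fin K → Fin (L + 1)) (i : Fin (L + 1)) (W : Messages K L) :
    xorBits W (mask U (r + Pi.single x i)) =
      paddedBit (W x) (r x + i) + ∑ k ∈ Finset.univ.erase x, paddedBit (W k) (mask U r k) := by
  rw [xorBits, ← Finset.add_sum_erase _ _ (Finset.mem_univ x)]
  congr 1
  · simp [mask, hx]
  · refine Finset.sum_congr rfl fun k hk => ?_
    simp [mask, Pi.single_eq_of_ne (Finset.ne_of_mem_erase hk)]

/-- The server with `r x + i = 0` reveals the interference, hence the other servers reveal the
bits of message `x`. -/
lemma eq_of_xorAnswer_eq {U : Finset (Fin K)} {x : Fin K} (hx : x ∈ U)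
    (r : Fin K → Fin (L + 1)) (W W' : Messages K L)
    (h : ∀ i, xorAnswer W (mask U (r + Pi.single x i)) =
      xorAnswer W' (mask U (r + Pi.single x i))) : W x = W' x := by
  have key : ∀ i, _ := fun i => xorBits_eq_of_xorAnswer_eq (h i)
  simp only [xorBits_mask_add_single hx] at key
  have h0 := key (-r x)
  simp only [add_neg_cancel, paddedBit_zero, zero_add] at h0
  funext j
  have hj := key (j.succ - r x)
  rw [h0] at hj
  simpa using add_right_cancel hj

lemma card_mask_eq_zero (U : Finset (Fin K)) :
    (Finset.univ.filter fun r : Fin K → Fin (L + 1) => mask U r = 0).card * (L + 1) ^ U.card =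
      (L + 1) ^ K := by
  have : (Finset.univ.filter fun r : Fin K → Fin (L + 1) => mask U r = 0) =
      Fintype.piFinset fun k => if k ∈ U then {0} else Finset.univ := by
    ext r
    simp only [Finset.mem_filter, Finset.mem_univ, true_and, Fintype.mem_piFinset, funext_iff, mask]
    refine forall_congr' fun k => ?_
    by_cases hk : k ∈ U <;> simp [hk]
  rw [this, Fintype.card_piFinset]
  have hc : ∀ k : Fin K, (if k ∈ U then {0} else Finset.univ : Finset (Fin (L + 1))).card =
      if k ∈ U then 1 else L + 1 := fun k => by split_ifs <;> simp
  have hU : (L + 1) ^ U.card = ∏ k : Fin K, if k ∈ U then L + 1 else 1 := by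
    simp
  rw [hU, Finset.prod_congr rfl fun k _ => hc k, ← Finset.prod_mul_distrib,
    Finset.prod_congr rfl fun k _ => show _ = L + 1 by split_ifs <;> simp]
  simp

lemma mul_pirCost (L k : ℕ) :
    (L : ℝ) * pirCost (L + 1) k = (L + 1) * (1 - ((L + 1 : ℝ) ^ k)⁻¹) := by
  have hL : (L + 1 : ℝ) ≠ 0 := by positivity
  induction k with
  | zero => simp [pirCost]
  | succ k ih =>
    rw [pirCost, Finset.sum_range_succ, ← pirCost, mul_add, ih]
    push_cast
    field_simp
    ring

/-- With `L + 1` servers and messages of `L` bits, for uniform `r` the server `i` is asked for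
the exclusive or of the bits at the positions `r k`, `k ∈ U`, with `r x` shifted by `i`, so that
the servers use all positions of message `x` once. A query of dummies only costs nothing, which
happens with probability `(L + 1)^{-|U|}`. -/
def xorPIR (K L : ℕ) : SymmetricPIR K (L + 1) L where
  Rand := Fin K → Fin (L + 1)
  Query := Fin K → Fin (L + 1)
  base := mask
  shift i x := Equiv.addRight (Pi.single x i)
  len q := if q = 0 then 0 else 1
  answer := xorAnswer
  answer_length W q := by unfold xorAnswer; split_ifs <;> rfl
  answer_congr U r W W' h := by simp only [xorAnswer, xorBits_mask_congr U r W W' h]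
  decode U x r W W' hx h := eq_of_xorAnswer_eq hx r W W' h
  cost U := by
    have hsum : ∑ r : Fin K → Fin (L + 1), (((if mask U r = 0 then 0 else 1 : ℕ) : ℝ)) =
        (L + 1 : ℝ) ^ K -
          (Finset.univ.filter fun r : Fin K → Fin (L + 1) => mask U r = 0).card := by
      have : ∀ r : Fin K → Fin (L + 1), (((if mask U r = 0 then 0 else 1 : ℕ) : ℝ)) =
          1 - if mask U r = 0 then 1 else 0 := fun r => by split_ifs <;> simp
      simp only [this, Finset.sum_sub_distrib, Finset.sum_boole]
      simp
    have hcard := congrArg (Nat.cast (R := ℝ)) (card_mask_eq_zero (L := L) U)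
    push_cast at hcard
    have hL : (L + 1 : ℝ) ^ U.card ≠ 0 := by positivity
    rw [hsum, mul_pirCost, eq_div_of_mul_eq hL hcard]
    simp only [Fintype.card_pi, Fintype.card_fin, Finset.prod_const, Finset.card_univ]
    push_cast
    field_simp

end ManyServers

lemma exists_symmetricPIR (K : ℕ) {N : ℕ} (hN : 1 ≤ N) :
    ∃ L, 0 < L ∧ Nonempty (SymmetricPIR K N L) := by
  obtain rfl | hN := hN.eq_or_lt
  · exact ⟨1, one_pos, ⟨singleServerPIR K⟩⟩
  · obtain ⟨L, rfl⟩ := Nat.exists_eq_add_of_lt hN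
    exact ⟨1 + L, by omega, ⟨xorPIR K (1 + L)⟩⟩

/-! ### The scheme of two independent retrievals -/

namespace SymmetricPIR

variable {K N L : ℕ} (P : SymmetricPIR K N L) {κ : Fin K × Fin K → Finset (Fin K) → ℝ}
  (hκ : ∀ r, κ r ∈ stdSimplex ℝ (Finset (Fin K))) {p : Fin K × Fin K → ℝ}

/-- The average of `f` over the uniform randomness of `P`. -/
def avg (f : P.Rand → ℝ) : ℝ := (Fintype.card P.Rand : ℝ)⁻¹ * ∑ r, f r

@[simp] lemma avg_const (a : ℝ) : P.avg (fun _ => a) = a := by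
  have : (Fintype.card P.Rand : ℝ) ≠ 0 := by simp
  simp [avg, this]

lemma avg_equiv (e : P.Rand ≃ P.Rand) (f : P.Rand → ℝ) : P.avg (fun r => f (e r)) = P.avg f := by
  simp only [avg, Equiv.sum_comp e f]

lemma avg_mul_right (a : ℝ) (f : P.Rand → ℝ) : P.avg (fun r => f r * a) = P.avg f * a := by
  simp only [avg, ← Finset.sum_mul]
  ring

/-- The probability of the query `q` in a retrieval over `U`. -/
def queryMass (U : Finset (Fin K)) (q : P.Query) : ℝ := by
  classical exact P.avg fun r => if P.base U r = q then 1 else 0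

lemma cost_avg (hL : 0 < L) (U : Finset (Fin K)) :
    ∑ _i : Fin N, P.avg (fun r => (P.len (P.base U r) : ℝ)) / L = pirCost N U.card := by
  have hR : (Fintype.card P.Rand : ℝ) ≠ 0 := by simp
  have hL' : (L : ℝ) ≠ 0 := by positivity
  have h := P.cost U
  simp only [avg, Finset.sum_const, Finset.card_univ, Fintype.card_fin, nsmul_eq_mul]
  field_simp
  linear_combination h

/-- The scheme that draws a set `U` with law `κ (s, x)`, retrieves message `s` over the set of
all messages and, with fresh randomness, message `x` over `U`. -/
def scheme : Scheme K N L where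
  Key := Finset (Fin K) × P.Rand × P.Rand
  Query := P.Query
  keyDist r f := κ r f.1 * (Fintype.card P.Rand : ℝ)⁻¹ * (Fintype.card P.Rand : ℝ)⁻¹
  keyDist_mem r := by
    refine ⟨fun f => mul_nonneg (mul_nonneg ((hκ r).1 _) (by positivity)) (by positivity), ?_⟩
    have : (Fintype.card P.Rand : ℝ) ≠ 0 := by simp
    rw [← (hκ r).2]
    simp only [Fintype.sum_prod_type, Finset.sum_const, Finset.card_univ, Fintype.card_prod,
      nsmul_eq_mul]
    refine Finset.sum_congr rfl fun u _ => ?_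
    push_cast
    field_simp
  query i s x f :=
    (P.base Finset.univ (P.shift i s f.2.1), P.base f.1 (P.shift i x f.2.2))
  len := P.len
  answer _ := P.answer
  answer_length _ := P.answer_length

/-- The set drawn as part of the key of `SymmetricPIR.scheme`. -/
def drawnSet (_s _x : Fin K) (f : (P.scheme hκ).Key) : Finset (Fin K) := f.1

/-- The joint law of the requests, the set `U` and the two queries to server `i`: given the
requests and `U`, the queries are independent with laws that depend on `U` only. -/
lemma expect_scheme (i : Fin N) (φ : Fin K → Fin K → Finset (Fin K) → P.Query → P.Query → ℝ) :
    expect ((P.scheme hκ).law p) (fun ω => φ ((P.scheme hκ).reqS ω) ((P.scheme hκ).reqX ω)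
      ((P.scheme hκ).obfSet (P.drawnSet hκ) ω)
      ((P.scheme hκ).queryS i ω) ((P.scheme hκ).queryX i ω)) =
    ∑ s, ∑ x, ∑ v, p (s, x) * κ (s, x) v * P.avg fun a => P.avg fun b =>
      φ s x v (P.base Finset.univ a) (P.base v b) := by
  have hM : (Fintype.card (Messages K L) : ℝ) ≠ 0 := by simp
  have hshift : ∀ s x v, (P.avg fun a => P.avg fun b =>
      φ s x v (P.base Finset.univ a) (P.base v b)) = P.avg fun a => P.avg fun b =>
      φ s x v (P.base Finset.univ (P.shift i s a)) (P.base v (P.shift i x b)) := fun s x v => by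
    rw [← P.avg_equiv (P.shift i s)]
    congr 1
    funext a
    rw [← P.avg_equiv (P.shift i x)]
  simp only [hshift]
  change ∑ ω : Messages K L × (Fin K × Fin K) × (Finset (Fin K) × P.Rand × P.Rand),
    (Fintype.card (Messages K L) : ℝ)⁻¹ * p ω.2.1 *
      (κ ω.2.1 ω.2.2.1 * (Fintype.card P.Rand : ℝ)⁻¹ * (Fintype.card P.Rand : ℝ)⁻¹) *
      φ ω.2.1.1 ω.2.1.2 ω.2.2.1 (P.base Finset.univ (P.shift i ω.2.1.1 ω.2.2.2.1))
        (P.base ω.2.2.1 (P.shift i ω.2.1.2 ω.2.2.2.2)) = _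
  rw [Fintype.sum_prod_type]
  simp only [Finset.sum_const, Finset.card_univ, nsmul_eq_mul]
  rw [Finset.mul_sum]
  simp only [Fintype.sum_prod_type, avg, Finset.mul_sum]
  refine Finset.sum_congr rfl fun s _ => Finset.sum_congr rfl fun x _ =>
    Finset.sum_congr rfl fun v _ => Finset.sum_congr rfl fun a _ =>
    Finset.sum_congr rfl fun b _ => ?_
  field_simp

lemma sum_law (hp : p ∈ stdSimplex ℝ (Fin K × Fin K)) : ∑ ω, (P.scheme hκ).law p ω = 1 := by
  have hM : (Fintype.card (Messages K L) : ℝ) ≠ 0 := by simp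
  rw [Fintype.sum_prod_type]
  simp only [Scheme.law]
  rw [Finset.sum_const, Finset.card_univ, nsmul_eq_mul,
    Fintype.sum_prod_type, ← hp.2, Finset.mul_sum]
  refine Finset.sum_congr rfl fun r _ => ?_
  dsimp only
  rw [← Finset.mul_sum, ((P.scheme hκ).keyDist_mem r).2]
  field_simp

/-- `SymmetricPIR.expect_scheme` for functions that do not involve the queries; it needs no
server. -/
lemma expect_scheme_set (φ : Fin K → Fin K → Finset (Fin K) → ℝ) :
    expect ((P.scheme hκ).law p) (fun ω => φ ((P.scheme hκ).reqS ω) ((P.scheme hκ).reqX ω)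
      ((P.scheme hκ).obfSet (P.drawnSet hκ) ω)) =
    ∑ s, ∑ x, ∑ v, p (s, x) * κ (s, x) v * φ s x v := by
  have hM : (Fintype.card (Messages K L) : ℝ) ≠ 0 := by simp
  have hR : (Fintype.card P.Rand : ℝ) ≠ 0 := by simp
  change ∑ ω : Messages K L × (Fin K × Fin K) × (Finset (Fin K) × P.Rand × P.Rand),
    (Fintype.card (Messages K L) : ℝ)⁻¹ * p ω.2.1 *
      (κ ω.2.1 ω.2.2.1 * (Fintype.card P.Rand : ℝ)⁻¹ * (Fintype.card P.Rand : ℝ)⁻¹) *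
      φ ω.2.1.1 ω.2.1.2 ω.2.2.1 = _
  rw [Fintype.sum_prod_type]
  simp only [Finset.sum_const, Finset.card_univ, nsmul_eq_mul]
  rw [Finset.mul_sum]
  simp only [Fintype.sum_prod_type, Finset.sum_const, Finset.card_univ, Fintype.card_prod,
    nsmul_eq_mul]
  refine Finset.sum_congr rfl fun s _ => Finset.sum_congr rfl fun x _ =>
    Finset.sum_congr rfl fun v _ => ?_
  push_cast
  field_simp

/-- The event `X ∈ U` holds on the support because `κ (s, x)` charges only sets that contain
`x`; so both retrievals are over sets that contain the requested message. -/
lemma correct (hmem : ∀ s x v, κ (s, x) v ≠ 0 → x ∈ v) : (P.scheme hκ).Correct p := by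
  constructor
  · refine condEntropy_eq_zero_of_determined _ _ ?_
    rintro ⟨W, ⟨s, x⟩, f⟩ ⟨W', ⟨s', x'⟩, f'⟩ _ _ h
    simp only [Prod.mk.injEq, Scheme.reqS, Scheme.key] at h
    obtain ⟨rfl, rfl, -, h⟩ := h
    exact P.decode Finset.univ s f.2.1 W W' (Finset.mem_univ _) fun i => congrFun h i
  · refine condEntropy_eq_zero_of_determined _ _ ?_
    rintro ⟨W, ⟨s, x⟩, f⟩ ⟨W', ⟨s', x'⟩, f'⟩ hω _ h
    simp only [Prod.mk.injEq, Scheme.reqX, Scheme.key] at h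
    obtain ⟨rfl, rfl, -, h⟩ := h
    refine P.decode f.1 x f.2.2 W W' (hmem s x f.1 fun h0 => hω ?_) fun i => congrFun h i
    simp [Scheme.law, scheme, h0]

section Independence

variable {ν : Finset (Fin K) → ℝ}
  (hν : ∀ s v, ∑ x, p (s, x) * κ (s, x) v = (∑ x, p (s, x)) * ν v)
include hν

lemma private_scheme (hp : p ∈ stdSimplex ℝ (Fin K × Fin K)) : (P.scheme hκ).Private p := by
  classical
  intro i
  refine mutualInfo_eq_zero_of_factor (α := Fin K) (β := P.Query × P.Query) (P.sum_law hκ hp) _ _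
    (fun s => ∑ x, p (s, x))
    (fun q => ∑ v, ν v * (P.queryMass Finset.univ q.1 * P.queryMass v q.2)) ?_
  rintro s ⟨a, b⟩
  rw [massFn_eq_expect]
  refine (P.expect_scheme hκ i fun s' _ _ a' b' => if (s', a', b') = (s, a, b) then 1 else 0).trans
    ?_
  have h : ∀ s' v, (P.avg fun r => P.avg fun r' =>
      if (s', P.base Finset.univ r, P.base v r') = (s, a, b) then (1 : ℝ) else 0) =
      if s' = s then P.queryMass Finset.univ a * P.queryMass v b else 0 := fun s' v => by
    by_cases hs : s' = s
    · simp only [queryMass, hs, ← avg_mul_right]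
      simp only [Prod.mk.injEq, true_and, if_true, ite_and, ite_mul, one_mul,
        zero_mul]
      congr! 3
      split_ifs <;> simp
    · simp [hs]
  simp only [h, mul_ite, mul_zero, Finset.sum_ite_irrel, Finset.sum_const_zero,
    Finset.sum_ite_eq', Finset.mem_univ, if_true]
  rw [Finset.sum_comm, Finset.mul_sum]
  refine Finset.sum_congr rfl fun v _ => ?_
  rw [← Finset.sum_mul, hν]
  ring

lemma isObfuscation (hp : p ∈ stdSimplex ℝ (Fin K × Fin K))
    (hmem : ∀ s x v, κ (s, x) v ≠ 0 → x ∈ v) :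
    (P.scheme hκ).IsObfuscation p (P.drawnSet hκ) := by
  classical
  constructor
  · rw [prob_eq_expect]
    refine (P.expect_scheme_set hκ fun _ x v => if x ∈ v then 1 else 0).trans (Eq.trans ?_ hp.2)
    rw [Fintype.sum_prod_type]
    refine Finset.sum_congr rfl fun s _ => Finset.sum_congr rfl fun x _ => ?_
    have h : ∑ v, p (s, x) * κ (s, x) v = p (s, x) := by
      rw [← Finset.mul_sum, (hκ (s, x)).2, mul_one]
    refine (Finset.sum_congr rfl fun v _ => ?_).trans h
    by_cases h : κ (s, x) v = 0
    · simp [h]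
    · simp [hmem s x v h]
  · refine mutualInfo_eq_zero_of_factor (P.sum_law hκ hp) _ _ (fun s => ∑ x, p (s, x)) ν ?_
    intro s v
    rw [massFn_eq_expect]
    refine (P.expect_scheme_set hκ fun s' _ v' => if (s', v') = (s, v) then 1 else 0).trans ?_
    simp [ite_and, Finset.sum_ite_irrel, hν]

lemma prob_card_le (hp : p ∈ stdSimplex ℝ (Fin K × Fin K)) (i : ℕ) :
    prob ((P.scheme hκ).law p)
      {ω | ((P.scheme hκ).obfSet (P.drawnSet hκ) ω).card ≤ i} =
        ∑ v, if v.card ≤ i then ν v else 0 := by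
  classical
  rw [prob_eq_expect]
  refine (P.expect_scheme_set hκ fun _ _ v => if v.card ≤ i then 1 else 0).trans ?_
  rw [Finset.sum_congr rfl fun s _ => Finset.sum_comm, Finset.sum_comm]
  refine Finset.sum_congr rfl fun v _ => ?_
  have hp1 : ∑ s, ∑ x, p (s, x) = 1 := by rw [← hp.2, Fintype.sum_prod_type]
  simp only [← Finset.sum_mul, hν, hp1]
  simp

end Independence

lemma costS_scheme (hL : 0 < L) (hp : p ∈ stdSimplex ℝ (Fin K × Fin K)) :
    (P.scheme hκ).costS p = pirCost N K := by
  have h : ∀ i, expect ((P.scheme hκ).law p)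
      (fun ω => ((P.scheme hκ).len ((P.scheme hκ).queryS i ω) : ℝ)) =
        P.avg fun r => (P.len (P.base Finset.univ r) : ℝ) := fun i => by
    refine (P.expect_scheme hκ i fun _ _ _ a _ => (P.len a : ℝ)).trans ?_
    simp only [avg_const, ← Finset.sum_mul, ← Finset.mul_sum, (hκ _).2, mul_one]
    rw [← Fintype.sum_prod_type, hp.2, one_mul]
  simp only [Scheme.costS, h, P.cost_avg hL, Finset.card_univ, Fintype.card_fin]

lemma costX_scheme (hL : 0 < L) :
    (P.scheme hκ).costX p = expect ((P.scheme hκ).law p)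
      fun ω => pirCost N ((P.scheme hκ).obfSet (P.drawnSet hκ) ω).card := by
  refine Eq.trans ?_ (P.expect_scheme_set hκ fun _ _ v => pirCost N v.card).symm
  have h : ∀ i, expect ((P.scheme hκ).law p)
      (fun ω => ((P.scheme hκ).len ((P.scheme hκ).queryX i ω) : ℝ)) =
        ∑ s, ∑ x, ∑ v, p (s, x) * κ (s, x) v * P.avg fun r => (P.len (P.base v r) : ℝ) :=
    fun i => by
      refine (P.expect_scheme hκ i fun _ _ _ _ b => (P.len b : ℝ)).trans ?_
      simp only [avg_const]
  simp only [Scheme.costX, h, ← P.cost_avg hL, Finset.sum_const, Finset.sum_div,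
    Finset.smul_sum, nsmul_eq_mul]
  refine Finset.sum_congr rfl fun s _ => Finset.sum_congr rfl fun x _ =>
    Finset.sum_congr rfl fun v _ => by ring

lemma retrievesOver (hL : 0 < L) :
    (P.scheme hκ).RetrievesOver p (P.drawnSet hκ) := by
  classical
  refine ⟨fun i s x f W W' h => P.answer_congr _ _ _ _ h, fun i => ?_, fun i => ?_, fun v hv => ?_⟩
  · refine condMutualInfo_eq_zero_of_factor (α := P.Query) _ _ _ (fun q v => P.queryMass v q)
      (fun x v => ∑ s, p (s, x) * κ (s, x) v) ?_
    intro q x v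
    rw [massFn_eq_expect]
    refine (P.expect_scheme hκ i fun _ x' v' _ b =>
      if (b, x', v') = (q, x, v) then 1 else 0).trans ?_
    have h : ∀ x' v', (P.avg fun _ => P.avg fun r =>
        if (P.base v' r, x', v') = (q, x, v) then (1 : ℝ) else 0) =
        if x' = x then if v' = v then P.queryMass v q else 0 else 0 := fun x' v' => by
      by_cases hx : x' = x <;> by_cases hv : v' = v <;> simp [hx, hv, queryMass]
    simp only [h]
    simp [Finset.sum_ite_irrel, ← Finset.sum_mul, mul_comm]
  · refine condMutualInfo_eq_zero_of_factor (α := P.Query) _ _ _ (fun q t => P.queryMass t.2 q)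
      (fun s t => p (s, t.1) * κ (s, t.1) t.2) ?_
    rintro q s ⟨x, v⟩
    rw [massFn_eq_expect]
    refine (P.expect_scheme hκ i fun s' x' v' _ b =>
      if (b, s', x', v') = (q, s, x, v) then 1 else 0).trans ?_
    have h : ∀ s' x' v', (P.avg fun _ => P.avg fun r =>
        if (P.base v' r, s', x', v') = (q, s, x, v) then (1 : ℝ) else 0) =
        if s' = s then if x' = x then if v' = v then P.queryMass v q else 0 else 0 else 0 :=
      fun s' x' v' => by
        by_cases hs : s' = s <;> by_cases hx : x' = x <;> by_cases hv : v' = v <;>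
          simp [hs, hx, hv, queryMass]
    simp only [h]
    simp [Finset.sum_ite_irrel, mul_comm]
  · have hprob : prob ((P.scheme hκ).law p) {ω | (P.scheme hκ).obfSet (P.drawnSet hκ) ω = v} =
        ∑ s, ∑ x, p (s, x) * κ (s, x) v := by
      rw [prob_eq_expect]
      refine (P.expect_scheme_set hκ fun _ _ v' => if v' = v then 1 else 0).trans ?_
      simp
    have h : ∀ i, expect ((P.scheme hκ).law p)
        ({ω | (P.scheme hκ).obfSet (P.drawnSet hκ) ω = v}.indicator
          fun ω => ((P.scheme hκ).len ((P.scheme hκ).queryX i ω) : ℝ)) =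
        (∑ s, ∑ x, p (s, x) * κ (s, x) v) * P.avg fun r => (P.len (P.base v r) : ℝ) :=
      fun i => by
        refine Eq.trans (congrArg _ (funext fun ω => ?_)) ((P.expect_scheme (p := p) hκ i
          fun _ _ v' _ b => if v' = v then (P.len b : ℝ) else 0).trans ?_)
        · exact Set.indicator_apply _ _ _
        · have h' : ∀ v', (P.avg fun _ => P.avg fun r =>
              if v' = v then (P.len (P.base v' r) : ℝ) else 0) =
              if v' = v then P.avg fun r => (P.len (P.base v r) : ℝ) else 0 := fun v' => by
            by_cases hv : v' = v <;> simp [hv]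
          simp [h', Finset.sum_mul]
    rw [hprob] at hv ⊢
    rw [div_eq_iff hv.ne', ← P.cost_avg hL v, Finset.sum_mul]
    refine Finset.sum_congr rfl fun i _ => ?_
    rw [h]
    ring

end SymmetricPIR

/-! ### Obfuscation by a coupling -/

section Levels

variable {K : ℕ} (w : Fin K → Fin K → ℝ)

/-- The `j`-th smallest entry of the column of `x` for `1 ≤ j ≤ K`, with the value `0` for
`j = 0` (and, without meaning, for `j > K`). -/
def level (x : Fin K) : ℕ → ℝ
  | 0 => 0
  | j + 1 => if h : j < K then w (Tuple.sort (fun s => w s x) ⟨j, h⟩) x else 0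

/-- The position, counted from `0`, of `s` in the increasing order of the column of `x`. -/
def rank (x s : Fin K) : Fin K := (Tuple.sort fun s => w s x).symm s

lemma lam_eq_sum_level (j : ℕ) : lam w j = ∑ x, level w x j := by
  cases j with
  | zero => simp [lam, level]
  | succ j => by_cases h : j < K <;> simp [lam, level, h]

lemma level_rank (x s : Fin K) : level w x (rank w x s + 1) = w s x := by
  simp [level, rank]

lemma sum_theta (n : ℕ) :
    ∑ j ∈ Finset.range n, theta w (j + 1) = min 1 (lam w n) := by
  simp only [theta, Nat.add_sub_cancel]
  rw [Finset.sum_range_sub (fun j => min 1 (lam w j))]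
  simp [lam]

/-- The mass of the cell `(x, j)`: the increment of the column of `x` from its `j`-th to its
`(j + 1)`-th smallest entry, scaled by a factor in `[0, 1]` that depends on `j` only and reduces
the total mass of the level `j` from `λ_{j+1} - λ_j` to `θ_{j+1}`. For `λ_{j+1} = λ_j` the factor is
the junk value `θ_{j+1} / 0 = 0`, and the increments and `θ_{j+1}` vanish anyway. -/
def cellMass (x : Fin K) (j : ℕ) : ℝ :=
  (level w x (j + 1) - level w x j) * (theta w (j + 1) / (lam w (j + 1) - lam w j))

variable {w} (hw : ∀ s, w s ∈ stdSimplex ℝ (Fin K))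
include hw

lemma level_le_succ (x : Fin K) {j : ℕ} (hj : j < K) : level w x j ≤ level w x (j + 1) := by
  cases j with
  | zero => simpa [level, hj] using (hw _).1 x
  | succ j =>
    have hj' : j < K := by omega
    simp only [level, hj, hj', dif_pos]
    exact Tuple.monotone_sort (fun s => w s x) (Fin.mk_le_mk.mpr j.le_succ)

lemma lam_le_succ {j : ℕ} (hj : j < K) : lam w j ≤ lam w (j + 1) := by
  simp only [lam_eq_sum_level]
  exact Finset.sum_le_sum fun x _ => level_le_succ hw x hj

lemma one_le_lam (hK : 0 < K) : 1 ≤ lam w K := by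
  obtain ⟨n, rfl⟩ : ∃ n, K = n + 1 := ⟨K - 1, by omega⟩
  rw [← (hw 0).2, lam_eq_sum_level]
  refine Finset.sum_le_sum fun x _ => ?_
  rw [← level_rank w x 0]
  simp only [level, Nat.lt_succ_self, Fin.is_lt, dif_pos]
  exact Tuple.monotone_sort (fun s => w s x) (Fin.le_last _)

lemma theta_nonneg {j : ℕ} (hj : j < K) : 0 ≤ theta w (j + 1) :=
  sub_nonneg.mpr (min_le_min_left 1 (lam_le_succ hw hj))

lemma theta_le {j : ℕ} (hj : j < K) : theta w (j + 1) ≤ lam w (j + 1) - lam w j := by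
  have := lam_le_succ hw hj
  simp only [theta, Nat.add_sub_cancel]
  rcases min_cases 1 (lam w j) with h | h <;> rcases min_cases 1 (lam w (j + 1)) with h' | h' <;>
    linarith

lemma cellMass_nonneg (x : Fin K) {j : ℕ} (hj : j < K) : 0 ≤ cellMass w x j :=
  mul_nonneg (sub_nonneg.mpr (level_le_succ hw x hj))
    (div_nonneg (theta_nonneg hw hj) (sub_nonneg.mpr (lam_le_succ hw hj)))

lemma cellMass_le (x : Fin K) {j : ℕ} (hj : j < K) :
    cellMass w x j ≤ level w x (j + 1) - level w x j :=
  mul_le_of_le_one_right (sub_nonneg.mpr (level_le_succ hw x hj))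
    (div_le_one_of_le₀ (theta_le hw hj) (sub_nonneg.mpr (lam_le_succ hw hj)))

lemma sum_cellMass {j : ℕ} (hj : j < K) : ∑ x, cellMass w x j = theta w (j + 1) := by
  simp only [cellMass, ← Finset.sum_mul, Finset.sum_sub_distrib, ← lam_eq_sum_level]
  by_cases h : lam w (j + 1) - lam w j = 0
  · have h1 := theta_nonneg hw hj
    have h2 := theta_le hw hj
    rw [h] at h2 ⊢
    simp [le_antisymm h2 h1]
  · field_simp

lemma sum_sum_cellMass (hK : 0 < K) : ∑ y, ∑ j : Fin K, cellMass w y j = 1 := by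
  rw [Finset.sum_comm, Finset.sum_congr rfl fun (j : Fin K) _ => sum_cellMass hw j.2,
    Fin.sum_univ_eq_sum_range fun j => theta w (j + 1), sum_theta w, min_eq_left (one_le_lam hw hK)]

/-- The request law of `s` covers the masses of the cells `(x, j)` with `j ≤ rank w x s`. -/
lemma sum_owned_le (s x : Fin K) :
    ∑ j : Fin K, (if j ≤ rank w x s then cellMass w x j else 0) ≤ w s x := by
  have h1 : ∑ j : Fin K, (if j ≤ rank w x s then cellMass w x j else 0) ≤
      ∑ j : Fin K, if j ≤ rank w x s then level w x (j + 1) - level w x j else 0 :=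
    Finset.sum_le_sum fun j _ => by
      split_ifs
      · exact cellMass_le hw x j.2
      · rfl
  refine h1.trans (le_of_eq ?_)
  simp only [Fin.le_iff_val_le_val]
  rw [Fin.sum_univ_eq_sum_range
    (fun j => if j ≤ rank w x s then level w x (j + 1) - level w x j else 0), ← Finset.sum_filter,
    show (Finset.range K).filter (fun j => j ≤ (rank w x s : ℕ)) = Finset.range (rank w x s + 1) by
      ext j; simp; omega, Finset.sum_range_sub, level_rank]
  simp [level]

end Levels

section Coupling

variable {K : ℕ} {w : Fin K → Fin K → ℝ}

/-- An obfuscation of the laws `w s`: joint laws `joint s` of a message `x` and a set `v`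
containing `x`, with first marginal `w s` and a second marginal `setLaw` that does not depend on
`s`. -/
structure Obfuscation (w : Fin K → Fin K → ℝ) where
  joint : Fin K → Fin K → Finset (Fin K) → ℝ
  setLaw : Finset (Fin K) → ℝ
  joint_nonneg : ∀ s x v, 0 ≤ joint s x v
  mem_of_joint_ne_zero : ∀ s x v, joint s x v ≠ 0 → x ∈ v
  sum_set : ∀ s x, ∑ v, joint s x v = w s x
  sum_message : ∀ s v, ∑ x, joint s x v = setLaw v

/-- The law of `s` outside the cells it covers. -/
def residual (w : Fin K → Fin K → ℝ) (s x : Fin K) : ℝ :=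
  w s x - ∑ j : Fin K, if j ≤ rank w x s then cellMass w x j else 0

/-- The total mass of the cells that the law of `s` does not cover, which is the total mass of
`residual w s`. -/
def deficit (w : Fin K → Fin K → ℝ) (s : Fin K) : ℝ :=
  ∑ y, ∑ j : Fin K, if j ≤ rank w y s then 0 else cellMass w y j

/-- The normalized residual law; for `deficit w s = 0` it does not matter which law this is. -/
def substitute (w : Fin K → Fin K → ℝ) (s x : Fin K) : ℝ :=
  if deficit w s = 0 then w s x else residual w s x / deficit w s

/-- The sample space of the coupling: a cell `(y, j)` and a substitute for `y` for each `s`. -/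
abbrev CouplingSpace (K : ℕ) : Type := (Fin K × Fin K) × (Fin K → Fin K)

/-- The law of the coupling: the substitutes are independent of the cell and of each other. -/
def couplingMass (w : Fin K → Fin K → ℝ) (t : CouplingSpace K) : ℝ :=
  cellMass w t.1.1 t.1.2 * ∏ s, substitute w s (t.2 s)

/-- The non-private request, given that the private one is `s`: the message `y` of the cell if
`s` covers the cell, the substitute of `s` otherwise. -/
def couplingReq (w : Fin K → Fin K → ℝ) (s : Fin K) (t : CouplingSpace K) : Fin K :=
  if t.1.2 ≤ rank w t.1.1 s then t.1.1 else t.2 s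

/-- All the values that the non-private request could have for some `s`. -/
def couplingSet (w : Fin K → Fin K → ℝ) (t : CouplingSpace K) : Finset (Fin K) :=
  insert t.1.1 ((Finset.univ.filter fun s => ¬ t.1.2 ≤ rank w t.1.1 s).image t.2)

lemma couplingReq_mem (s : Fin K) (t : CouplingSpace K) :
    couplingReq w s t ∈ couplingSet w t := by
  unfold couplingReq couplingSet
  split_ifs with h
  · exact Finset.mem_insert_self _ _
  · exact Finset.mem_insert_of_mem (Finset.mem_image_of_mem _ (by simpa using h))

/-- Exactly `j` of the laws do not cover the cell `(y, j)`. -/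
lemma card_couplingSet_le (t : CouplingSpace K) : (couplingSet w t).card ≤ t.1.2 + 1 := by
  refine (Finset.card_insert_le _ _).trans (Nat.add_le_add_right (Finset.card_image_le.trans ?_) 1)
  rw [← Fin.card_Iio]
  refine Finset.card_le_card_of_injOn (rank w t.1.1) (fun s hs => ?_)
    (Equiv.injective _).injOn
  simpa using hs

/-- The marginal of one substitute. -/
lemma sum_prod_mul {ρ : Fin K → Fin K → ℝ} (hρ : ∀ s, ∑ x, ρ s x = 1) (s : Fin K)
    (f : Fin K → ℝ) :
    ∑ g : Fin K → Fin K, (∏ s', ρ s' (g s')) * f (g s) = ∑ x, ρ s x * f x := by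
  classical
  have h : ∀ g : Fin K → Fin K, (∏ s', ρ s' (g s')) * f (g s) =
      ∏ s', ρ s' (g s') * if s' = s then f (g s') else 1 := fun g => by
    rw [Finset.prod_mul_distrib]
    simp
  simp only [h]
  rw [← Fintype.prod_sum fun s' x => ρ s' x * if s' = s then f x else 1,
    Fintype.prod_eq_single s]
  · simp
  · intro s' hs'
    simp [hs', hρ]

variable (hw : ∀ s, w s ∈ stdSimplex ℝ (Fin K))
include hw

lemma residual_nonneg (s x : Fin K) : 0 ≤ residual w s x := sub_nonneg.mpr (sum_owned_le hw s x)

lemma deficit_nonneg (s : Fin K) : 0 ≤ deficit w s :=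
  Finset.sum_nonneg fun y _ => Finset.sum_nonneg fun j _ => by
    split_ifs
    · rfl
    · exact cellMass_nonneg hw y j.2

lemma sum_residual (s : Fin K) : ∑ x, residual w s x = deficit w s := by
  have h := sum_sum_cellMass hw s.pos
  simp only [residual, deficit, Finset.sum_sub_distrib, (hw s).2]
  rw [← h, ← Finset.sum_sub_distrib]
  refine Finset.sum_congr rfl fun y _ => ?_
  rw [← Finset.sum_sub_distrib]
  refine Finset.sum_congr rfl fun j _ => ?_
  split_ifs <;> simp

lemma deficit_mul_substitute (s x : Fin K) : deficit w s * substitute w s x = residual w s x := by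
  unfold substitute
  split_ifs with h
  · have h0 := sum_residual hw s
    rw [h] at h0
    rw [h, zero_mul, (Finset.sum_eq_zero_iff_of_nonneg fun x _ => residual_nonneg hw s x).mp h0 x
      (Finset.mem_univ x)]
  · field_simp

lemma substitute_mem (s : Fin K) : substitute w s ∈ stdSimplex ℝ (Fin K) := by
  by_cases h : deficit w s = 0
  · have : substitute w s = w s := funext fun x => if_pos h
    rw [this]
    exact hw s
  · have : substitute w s = fun x => residual w s x / deficit w s := funext fun x => if_neg h
    rw [this]
    refine ⟨fun x => div_nonneg (residual_nonneg hw s x) (deficit_nonneg hw s), ?_⟩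
    rw [← Finset.sum_div, sum_residual hw, div_self h]

lemma couplingMass_nonneg (t : CouplingSpace K) : 0 ≤ couplingMass w t :=
  mul_nonneg (cellMass_nonneg hw _ t.1.2.2)
    (Finset.prod_nonneg fun s _ => (substitute_mem hw s).1 _)

lemma sum_couplingMass_mul (f : Fin K × Fin K → ℝ) :
    ∑ t, couplingMass w t * f t.1 = ∑ y, ∑ j : Fin K, cellMass w y j * f (y, j) := by
  rw [Fintype.sum_prod_type, Fintype.sum_prod_type]
  refine Finset.sum_congr rfl fun y _ => Finset.sum_congr rfl fun j _ => ?_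
  have h : ∑ g : Fin K → Fin K, ∏ s, substitute w s (g s) = 1 := by
    rw [← Fintype.prod_sum]
    simp [(substitute_mem hw _).2]
  simp only [couplingMass, mul_right_comm _ _ (f _)]
  rw [← Finset.mul_sum, h, mul_one]

/-- In the coupling, the non-private request of `s` has the law `w s`: the cells that `s` covers
contribute the covered part, and the other cells the residual. -/
lemma sum_couplingReq (s x : Fin K) :
    ∑ t, (if couplingReq w s t = x then couplingMass w t else 0) = w s x := by
  have h : ∀ y j, ∑ g : Fin K → Fin K,
      (if couplingReq w s ((y, j), g) = x then couplingMass w ((y, j), g) else 0) =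
      (if j ≤ rank w y s then if y = x then cellMass w y j else 0 else 0) +
        (if j ≤ rank w y s then 0 else cellMass w y j) * substitute w s x := fun y j => by
    by_cases hj : j ≤ rank w y s
    · have h1 : ∑ g : Fin K → Fin K, ∏ s, substitute w s (g s) = 1 := by
        rw [← Fintype.prod_sum]
        simp [(substitute_mem hw _).2]
      by_cases hy : y = x
      · subst hy
        simp [couplingReq, couplingMass, hj, ← Finset.mul_sum, h1]
      · simp [couplingReq, hj, hy]
    · simp only [couplingReq, couplingMass, hj, if_false, zero_add]
      have h2 := sum_prod_mul (fun s => (substitute_mem hw s).2) s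
        fun z => if z = x then cellMass w y j else 0
      simp only [mul_ite, mul_zero, Finset.sum_ite_eq', Finset.mem_univ, if_true] at h2
      rw [mul_comm, ← h2]
      exact Finset.sum_congr rfl fun g _ => by rw [mul_comm]
  rw [Fintype.sum_prod_type, Fintype.sum_prod_type]
  simp only [h, Finset.sum_add_distrib, ← Finset.sum_mul]
  rw [← deficit, deficit_mul_substitute hw, residual]
  have h3 : ∑ y, ∑ j : Fin K,
      (if j ≤ rank w y s then if y = x then cellMass w y j else 0 else 0) =
      ∑ j : Fin K, if j ≤ rank w x s then cellMass w x j else 0 := by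
    rw [Finset.sum_comm]
    refine Finset.sum_congr rfl fun j _ => ?_
    rw [Fintype.sum_eq_single x fun y hy => by simp [hy]]
    simp
  rw [h3]
  ring

/-- The obfuscation given by the coupling. -/
def couplingObfuscation : Obfuscation w where
  joint s x v := ∑ t, if couplingReq w s t = x ∧ couplingSet w t = v then couplingMass w t else 0
  setLaw v := ∑ t, if couplingSet w t = v then couplingMass w t else 0
  joint_nonneg s x v := Finset.sum_nonneg fun t _ => by
    split_ifs
    · exact couplingMass_nonneg hw t
    · rfl
  mem_of_joint_ne_zero s x v h := by
    obtain ⟨t, -, ht⟩ := Finset.exists_ne_zero_of_sum_ne_zero h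
    obtain ⟨rfl, rfl⟩ := (ite_ne_right_iff.mp ht).1
    exact couplingReq_mem s t
  sum_set s x := by
    rw [← sum_couplingReq hw s x, Finset.sum_comm]
    refine Finset.sum_congr rfl fun t _ => ?_
    simp [ite_and, Finset.sum_ite_irrel]
  sum_message s v := by
    rw [Finset.sum_comm]
    refine Finset.sum_congr rfl fun t _ => ?_
    simp [ite_and]

/-- The cells `(y, j)` with `j < i` have total mass `θ_1 + ⋯ + θ_i` and yield sets with at most
`i` elements. -/
lemma sum_theta_le {i : ℕ} (hi : i ≤ K) : ∑ j ∈ Finset.Icc 1 i, theta w j ≤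
    ∑ v, if v.card ≤ i then (couplingObfuscation hw).setLaw v else 0 := by
  have h1 : ∑ j ∈ Finset.Icc 1 i, theta w j =
      ∑ t, couplingMass w t * if (t.1.2 : ℕ) < i then 1 else 0 := by
    rw [sum_couplingMass_mul hw (fun c => if (c.2 : ℕ) < i then 1 else 0), Finset.sum_comm]
    have h2 : ∀ j : Fin K, ∑ y, cellMass w y j * (if (j : ℕ) < i then 1 else 0) =
        if (j : ℕ) < i then theta w (j + 1) else 0 := fun j => by
      rw [← Finset.sum_mul, sum_cellMass hw j.2]
      simp
    simp only [h2]
    rw [Fin.sum_univ_eq_sum_range (fun j => if j < i then theta w (j + 1) else 0),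
      ← Finset.sum_filter, show (Finset.range K).filter (· < i) = Finset.range i by
        ext j; simp; omega, Finset.range_eq_Ico, Finset.sum_Ico_add' (fun j => theta w j)]
    rfl
  have h3 : ∑ v, (if v.card ≤ i then (couplingObfuscation hw).setLaw v else 0) =
      ∑ t, couplingMass w t * if (couplingSet w t).card ≤ i then 1 else 0 := by
    have h4 : ∀ v : Finset (Fin K), (if v.card ≤ i then (couplingObfuscation hw).setLaw v else 0) =
        ∑ t, if couplingSet w t = v then if v.card ≤ i then couplingMass w t else 0 else 0 :=
      fun v => by by_cases hv : v.card ≤ i <;> simp [hv, couplingObfuscation]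
    simp only [h4]
    rw [Finset.sum_comm]
    simp
  rw [h1, h3]
  refine Finset.sum_le_sum fun t _ => mul_le_mul_of_nonneg_left ?_ (couplingMass_nonneg hw t)
  have := card_couplingSet_le (w := w) t
  split_ifs <;> first | (exfalso; omega) | norm_num

end Coupling

section Kernel

variable {K : ℕ} {w : Fin K → Fin K → ℝ} (O : Obfuscation w)

/-- The conditional law of the set given the requests, with the full set for requests `x` that
have probability zero given `s`. -/
def Obfuscation.kernel (r : Fin K × Fin K) (v : Finset (Fin K)) : ℝ :=
  if w r.1 r.2 = 0 then if v = Finset.univ then 1 else 0 else O.joint r.1 r.2 v / w r.1 r.2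

lemma Obfuscation.kernel_mem (r : Fin K × Fin K) :
    O.kernel r ∈ stdSimplex ℝ (Finset (Fin K)) := by
  have hnn : 0 ≤ w r.1 r.2 := O.sum_set r.1 r.2 ▸ Finset.sum_nonneg fun v _ => O.joint_nonneg _ _ v
  by_cases h : w r.1 r.2 = 0
  · refine ⟨fun v => ?_, ?_⟩
    · simp only [kernel, h, if_true]
      split_ifs <;> norm_num
    · simp [kernel, h]
  · refine ⟨fun v => ?_, ?_⟩
    · simp only [kernel, h, if_false]
      exact div_nonneg (O.joint_nonneg _ _ v) hnn
    · simp only [kernel, h, if_false]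
      rw [← Finset.sum_div, O.sum_set, div_self h]

lemma Obfuscation.mem_of_kernel_ne_zero (s x : Fin K) (v : Finset (Fin K))
    (h : O.kernel (s, x) v ≠ 0) : x ∈ v := by
  by_cases h0 : w s x = 0
  · by_cases hv : v = Finset.univ
    · simp [hv]
    · simp [kernel, h0, hv] at h
  · refine O.mem_of_joint_ne_zero s x v fun hJ => h ?_
    simp [kernel, hJ, h0]

lemma Obfuscation.mul_kernel (s x : Fin K) (v : Finset (Fin K)) :
    w s x * O.kernel (s, x) v = O.joint s x v := by
  by_cases h : w s x = 0
  · have h0 := O.sum_set s x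
    rw [h] at h0
    rw [h, zero_mul, (Finset.sum_eq_zero_iff_of_nonneg fun v _ => O.joint_nonneg s x v).mp h0 v
      (Finset.mem_univ v)]
  · simp only [kernel, h, if_false]
    field_simp

/-- Given the private request `s`, the set has the law `O.setLaw`, whatever `s` is. -/
lemma Obfuscation.sum_mul_kernel {p : Fin K × Fin K → ℝ} (hpw : IsConditional p w) (s : Fin K)
    (v : Finset (Fin K)) :
    ∑ x, p (s, x) * O.kernel (s, x) v = (∑ x, p (s, x)) * O.setLaw v := by
  rw [← O.sum_message s v, Finset.mul_sum]
  refine Finset.sum_congr rfl fun x _ => ?_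
  rw [← O.mul_kernel, ← mul_assoc, ← hpw.2]

end Kernel

end IntermittentPIR

end

theorem theorem1 (K N : ℕ) (hN : 1 ≤ N) :
    ∃ L : ℕ, 0 < L ∧
      ∀ p : Fin K × Fin K → ℝ, p ∈ stdSimplex ℝ (Fin K × Fin K) →
      ∀ w : Fin K → Fin K → ℝ, IntermittentPIR.IsConditional p w →
        ∃ (c : IntermittentPIR.Scheme K N L) (u : Fin K → Fin K → c.Key → Finset (Fin K)),
          c.Correct p ∧ c.Private p ∧
          c.costS p = IntermittentPIR.pirCost N K ∧
          c.IsObfuscation p u ∧ c.RetrievesOver p u ∧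
          c.costX p = IntermittentPIR.expect (c.law p)
            (fun ω => IntermittentPIR.pirCost N (c.obfSet u ω).card) ∧
          ∀ i ∈ Finset.Icc 1 K,
            ∑ j ∈ Finset.Icc 1 i, IntermittentPIR.theta w j ≤
              IntermittentPIR.prob (c.law p) {ω | (c.obfSet u ω).card ≤ i} := by
  obtain ⟨L, hL, ⟨P⟩⟩ := IntermittentPIR.exists_symmetricPIR K hN
  refine ⟨L, hL, fun p hp w hw => ?_⟩
  let O := IntermittentPIR.couplingObfuscation hw.1
  have hν := O.sum_mul_kernel hw
  refine ⟨P.scheme O.kernel_mem, P.drawnSet O.kernel_mem, P.correct _ O.mem_of_kernel_ne_zero,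
    P.private_scheme _ hν hp, P.costS_scheme _ hL hp,
    P.isObfuscation _ hν hp O.mem_of_kernel_ne_zero, P.retrievesOver _ hL,
    P.costX_scheme _ hL, fun i hi => ?_⟩
  rw [P.prob_card_le _ hν hp]
  exact IntermittentPIR.sum_theta_le hw.1 (Finset.mem_Icc.mp hi).2
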